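/- Let $k$ be a field of characteristic $0$ equipped with a field automorphism $\sigma$ and a derivation $\delta$ with $\sigma\delta=\delta\sigma$ (a $\sigma\delta$-field). For any $\sigma\delta$-field $K$ write $C_K=\{x\in K:\sigma(x)=x\}$ and let $D_K$ be the relative algebraic closure of $C_K$ in $K$. Assume $D_k=C_k$. Let $A\in GL_m(k)$, let $X$ be an $m\times m$ matrix of differential indeterminates over $k$, and let $L=k\langle X,\det(X)^{-1}\rangle$ be the differential field generated over $k$ by the entries of $X$, made into a $\sigma\delta$-field extension of $k$ by setting $\sigma(X)=AX$ and requiring $\sigma$ to commute with $\delta$. Let $kC_L$ be the subfield of $L$ generated by $k$ and $C_L$. Then the relative algebraic closure of $kC_L$ in $L$ is a finite extension of $kC_L$; moreover, $l=[D_L:C_L]$ is finite. -/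

import Mathlib

/-- A difference-differential field (`σδ`-field): a field `K` with a field automorphism `σ` and a
derivation `δ` commuting with each other. -/
class SigmaDeltaField (K : Type*) [Field K] where
  /-- The automorphism. -/
  σ : K ≃+* K
  /-- The derivation. -/
  δ : Derivation ℤ K K
  σ_δ_comm : ∀ x : K, σ (δ x) = δ (σ x)

namespace SigmaDeltaField

/-- The field `C_K = Fix(σ)(K)` of `σ`-constants of `K`. -/
def constants (K : Type*) [Field K] [SigmaDeltaField K] : Subfield K where
  carrier := {x | σ x = x}
  mul_mem' {a b} ha hb := by
    simp only [Set.mem_ofPred_eq] at *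
    rw [map_mul, ha, hb]
  one_mem' := by simp
  add_mem' {a b} ha hb := by
    simp only [Set.mem_ofPred_eq] at *
    rw [map_add, ha, hb]
  zero_mem' := by simp
  neg_mem' {a} ha := by
    simp only [Set.mem_ofPred_eq] at *
    rw [map_neg, ha]
  inv_mem' a ha := by
    simp only [Set.mem_ofPred_eq] at *
    rw [map_inv₀, ha]

/-- The field `D_K`: the relative algebraic closure of `C_K` in `K`. -/
noncomputable abbrev algConstants (K : Type*) [Field K] [SigmaDeltaField K] :
    IntermediateField (constants K) K :=
  algebraicClosure (constants K) K

end SigmaDeltaField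

open SigmaDeltaField (σ δ)

/-- `L` is a `σδ`-field extension of `k`: the inclusion `k → L` commutes with `σ` and `δ`. -/
class SigmaDeltaExtension (k L : Type*) [Field k] [Field L] [Algebra k L]
    [SigmaDeltaField k] [SigmaDeltaField L] : Prop where
  σ_algebraMap : ∀ a : k, σ (algebraMap k L a) = algebraMap k L (σ a)
  δ_algebraMap : ∀ a : k, δ (algebraMap k L a) = algebraMap k L (δ a)

/-- The family of all entries of all derivatives `X, X', X'', …` of a square matrix `X`;
the index `(a, b, j)` gives the `j`-th derivative of the entry `X a b`. -/
def matrixDerivatives {L : Type*} [Field L] [SigmaDeltaField L] {m : ℕ}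
    (X : Matrix (Fin m) (Fin m) L) : Fin m × Fin m × ℕ → L :=
  fun i => (⇑(δ : Derivation ℤ L L))^[i.2.2] (X i.1 i.2.1)

/-- The `σδ`-field extension `L` of `k` is `k⟨X, det(X)⁻¹⟩` for the matrix `X` of differential
indeterminates over `k`, with `σ` extended to `L` by `σ(X) = A X` and commutation with `δ`. -/
structure IsGenericSolutionField {k L : Type*} [Field k] [Field L] [Algebra k L]
    [SigmaDeltaField k] [SigmaDeltaField L] {m : ℕ} (A : GL (Fin m) k)
    (X : Matrix (Fin m) (Fin m) L) : Prop where
  /-- `L` is an extension of `k` as a `σδ`-field. -/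
  extension : SigmaDeltaExtension k L
  /-- The entries of `X` are differentially algebraically independent over `k`. -/
  indeterminates : AlgebraicIndependent k (matrixDerivatives X)
  /-- `L` is generated over `k` as a differential field by the entries of `X`. -/
  generates : IntermediateField.adjoin k (Set.range (matrixDerivatives X)) = ⊤
  /-- The difference equation `σ(X) = A X`. -/
  equation : X.map σ = (A : Matrix (Fin m) (Fin m) k).map (algebraMap k L) * X

/-- The compositum `k C_L` inside `L`. -/
noncomputable abbrev compositumConstants (k L : Type*) [Field k] [Field L] [Algebra k L]
    [SigmaDeltaField L] : IntermediateField k L :=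
  IntermediateField.adjoin k (SigmaDeltaField.constants L : Set L)

section

open MvPolynomial

/-- A derivation from a ring homomorphism into the dual numbers. -/
theorem exists_derivation_of_dual {R B : Type*} [CommRing R] [CommRing B] [Algebra R B]
    (H : R →+* TrivSqZeroExt B B) (hH : ∀ x, (H x).fst = algebraMap R B x) :
    ∃ D : Derivation ℤ R B, ∀ x, D x = (H x).snd := by
  refine ⟨Derivation.mk' (AddMonoidHom.toIntLinearMap
    { toFun := fun x => (H x).snd, map_zero' := by simp, map_add' := by simp }) ?_, ?_⟩
  · intro a b
    simp [TrivSqZeroExt.snd_mul, hH, Algebra.smul_def, mul_comm]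
  · intro x
    rfl

/-- A ring homomorphism into the dual numbers from a derivation. -/
theorem exists_dual_of_derivation {R B : Type*} [CommRing R] [CommRing B] [Algebra R B]
    (D : Derivation ℤ R B) :
    ∃ H : R →+* TrivSqZeroExt B B, ∀ x, (H x).fst = algebraMap R B x ∧ (H x).snd = D x := by
  refine ⟨{ toFun := fun x => TrivSqZeroExt.inl (algebraMap R B x) + TrivSqZeroExt.inr (D x),
            map_zero' := ?_, map_one' := ?_, map_add' := ?_, map_mul' := ?_ },
          fun x => by simp⟩
  · ext <;> simp
  · intro a b
    ext
    · simp
    · simp only [TrivSqZeroExt.snd_mul, TrivSqZeroExt.snd_add, TrivSqZeroExt.snd_inl,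
        TrivSqZeroExt.snd_inr, TrivSqZeroExt.fst_add, TrivSqZeroExt.fst_inl,
        TrivSqZeroExt.fst_inr, Derivation.leibniz, Algebra.smul_def, Algebra.algebraMap_self_apply,
        MulOpposite.smul_eq_mul_unop, MulOpposite.unop_op]
      ring
  · ext <;> simp
  · intro a b
    ext <;> simp

/-- The first projection of the dual numbers. -/
theorem exists_fst_ringHom (B : Type*) [CommRing B] :
    ∃ f : TrivSqZeroExt B B →+* B, ∀ x, f x = x.fst :=
  ⟨{ toFun := fun x => x.fst, map_zero' := by simp, map_one' := by simp,
     map_add' := by simp, map_mul' := by simp }, fun _ => rfl⟩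

/-- The field of differential rational functions in a matrix `X` of indeterminates, with `σ`
extended by `σ(X) = A X`, exists. -/
theorem exists_isGenericSolutionField.{u} {k : Type u} [Field k] [SigmaDeltaField k] {m : ℕ}
    (A : GL (Fin m) k) :
    ∃ (L : Type u) (_ : Field L) (_ : Algebra k L) (_ : SigmaDeltaField L)
      (X : Matrix (Fin m) (Fin m) L), IsGenericSolutionField A X := by
  let R := MvPolynomial (Fin m × Fin m × ℕ) k
  let L := FractionRing R
  -- the derivation on the ring of differential polynomials
  obtain ⟨dk, hdk⟩ : ∃ dk : Derivation ℤ k R, ∀ a, dk a = C (δ a) :=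
    ⟨Derivation.mk' (AddMonoidHom.toIntLinearMap
      { toFun := fun a => (C (δ a) : R), map_zero' := by simp, map_add' := by simp }) (by
        intro a b; simp [Algebra.smul_def]; rfl), fun a => rfl⟩
  obtain ⟨Hk, hHk⟩ := exists_dual_of_derivation dk
  let g : Fin m × Fin m × ℕ → TrivSqZeroExt R R := fun i =>
    TrivSqZeroExt.inl (X i) + TrivSqZeroExt.inr (X (i.1, i.2.1, i.2.2 + 1))
  let HR : R →+* TrivSqZeroExt R R := eval₂Hom Hk g
  have HRC : ∀ a, HR (C a) = Hk a := eval₂Hom_C Hk g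
  have HRX : ∀ i, HR (X i) = g i := eval₂Hom_X' Hk g
  obtain ⟨fR, hfR⟩ := exists_fst_ringHom R
  have hHR : fR.comp HR = RingHom.id R := by
    apply MvPolynomial.ringHom_ext
    · intro a
      rw [RingHom.comp_apply, HRC, hfR, (hHk a).1]
      rfl
    · intro i
      rw [RingHom.comp_apply, HRX, hfR]
      simp [g]; rfl
  obtain ⟨dR, hdR⟩ := exists_derivation_of_dual HR
    (fun x => (hfR _).symm.trans (RingHom.congr_fun hHR x))
  have dRC : ∀ a, dR (C a) = C (δ a) := by
    intro a
    rw [hdR, HRC, (hHk a).2, hdk]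
  have dRX : ∀ a b j, dR (X (a, b, j)) = X (a, b, j + 1) := by
    intro a b j
    rw [hdR, HRX]
    simp [g]
  have dRX' : ∀ j a b, (⇑dR)^[j] (X (a, b, 0)) = X (a, b, j) := by
    intro j a b
    induction j with
    | zero => rfl
    | succ j ih => rw [Function.iterate_succ_apply', ih, dRX]
  -- endomorphisms `X ↦ B X` over an automorphism of `k`
  have key : ∀ (s : k ≃+* k) (hs : ∀ a, s (δ a) = δ (s a)) (B : Matrix (Fin m) (Fin m) k),
      ∃ S : R →+* R, (∀ a, S (C a) = C (s a)) ∧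
        (∀ a b, S (X (a, b, 0)) = ∑ c, C (B a c) * X (c, b, 0)) ∧
        (∀ p, S (dR p) = dR (S p)) := by
    intro s hs B
    let S : R →+* R := eval₂Hom (C.comp s.toRingHom)
      (fun i => (⇑dR)^[i.2.2] (∑ c, C (B i.1 c) * X (c, i.2.1, 0)))
    have SC : ∀ a, S (C a) = C (s a) := by intro a; exact eval₂_C _ _ a
    have SX : ∀ i, S (X i) = (⇑dR)^[i.2.2] (∑ c, C (B i.1 c) * X (c, i.2.1, 0)) := by
      intro i; exact eval₂_X _ _ i
    refine ⟨S, SC, fun a b => by rw [SX]; rfl, ?_⟩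
    intro p
    induction p using MvPolynomial.induction_on with
    | C a => rw [dRC, SC, SC, dRC, hs]
    | add p q hp hq => simp only [map_add, hp, hq]
    | mul_X p i hp =>
      have : S (dR (X i)) = dR (S (X i)) := by
        obtain ⟨a, b, j⟩ := i
        rw [dRX, SX, SX, Function.iterate_succ_apply']
      simp only [Derivation.leibniz, map_add, smul_eq_mul, map_mul, hp, this]
  have inv : ∀ (S T : R →+* R) (s t : k ≃+* k) (B D : Matrix (Fin m) (Fin m) k),
      (∀ a, S (C a) = C (s a)) → (∀ a b, S (X (a, b, 0)) = ∑ c, C (B a c) * X (c, b, 0)) →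
      (∀ p, S (dR p) = dR (S p)) →
      (∀ a, T (C a) = C (t a)) → (∀ a b, T (X (a, b, 0)) = ∑ c, C (D a c) * X (c, b, 0)) →
      (∀ p, T (dR p) = dR (T p)) →
      (∀ a, s (t a) = a) → D.map s * B = 1 → S.comp T = RingHom.id R := by
    intro S T s t B D SC SX Sd TC TX Td hst hDB
    apply MvPolynomial.ringHom_ext
    · intro a; simp [SC, TC, hst]
    · have h0 : ∀ a b, S (T (X (a, b, 0))) = X (a, b, 0) := by
        intro a b
        simp only [TX, map_sum, map_mul, SC, SX, Finset.mul_sum]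
        rw [Finset.sum_comm]
        simp only [← mul_assoc, ← map_mul, ← Finset.sum_mul, ← map_sum]
        have : ∀ c, ∑ x, s (D a x) * B x c = (1 : Matrix (Fin m) (Fin m) k) a c := by
          intro c; rw [← hDB]; simp [Matrix.mul_apply]
        simp [this, Matrix.one_apply]
      rintro ⟨a, b, j⟩
      show S (T (X (a, b, j))) = X (a, b, j)
      induction j with
      | zero => exact h0 a b
      | succ j ih => rw [← dRX, Td, Sd, ih]
  have hsymm : ∀ a : k, (σ : k ≃+* k).symm (δ a) = δ ((σ : k ≃+* k).symm a) := by
    intro a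
    apply (σ : k ≃+* k).injective
    rw [SigmaDeltaField.σ_δ_comm]; simp
  obtain ⟨S, SC, SX, Sd⟩ := key σ SigmaDeltaField.σ_δ_comm A.1
  obtain ⟨T, TC, TX, Td⟩ := key (σ : k ≃+* k).symm hsymm ((A⁻¹).1.map (σ : k ≃+* k).symm)
  let e : R ≃+* R := RingEquiv.ofRingHom S T
    (inv S T σ (σ : k ≃+* k).symm _ _ SC SX Sd TC TX Td (by simp) (by
      rw [Matrix.map_map]
      have : (⇑(σ : k ≃+* k) ∘ ⇑(σ : k ≃+* k).symm) = id := by ext; simp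
      rw [this, Matrix.map_id]
      exact A.inv_mul))
    (inv T S (σ : k ≃+* k).symm σ _ _ TC TX Td SC SX Sd (by simp) (by
      have h := congrArg (fun M => Matrix.map M (σ : k ≃+* k).symm) A.mul_inv
      simp only [Matrix.map_mul] at h
      rw [h]
      simp))
  -- extension to the fraction field
  let sL : L ≃+* L := IsFractionRing.ringEquivOfRingEquiv e
  have sL_alg : ∀ p, sL (algebraMap R L p) = algebraMap R L (S p) := by
    intro p; exact IsFractionRing.ringEquivOfRingEquiv_algebraMap e p
  obtain ⟨dRL, hdRL⟩ : ∃ d : Derivation ℤ R L, ∀ p, d p = algebraMap R L (dR p) :=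
    ⟨Derivation.mk' (AddMonoidHom.toIntLinearMap
      { toFun := fun p => algebraMap R L (dR p), map_zero' := by simp, map_add' := by simp }) (by
        intro a b; simp [Algebra.smul_def]), fun a => rfl⟩
  obtain ⟨HRL, hHRL⟩ := exists_dual_of_derivation dRL
  have hunit : ∀ y : nonZeroDivisors R, IsUnit (HRL y) := by
    intro y
    rw [TrivSqZeroExt.isUnit_iff_isUnit_fst, (hHRL _).1]
    exact IsLocalization.map_units L y
  let HL : L →+* TrivSqZeroExt L L := IsLocalization.lift hunit
  have HL_alg : ∀ p, HL (algebraMap R L p) = HRL p := fun p => IsLocalization.lift_eq hunit p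
  obtain ⟨fL, hfL⟩ := exists_fst_ringHom L
  have hHL : fL.comp HL = RingHom.id L := by
    apply IsLocalization.ringHom_ext (nonZeroDivisors R)
    apply RingHom.ext
    intro p
    rw [RingHom.comp_apply, RingHom.comp_apply, HL_alg, hfL, (hHRL p).1]
    rfl
  obtain ⟨dL, hdL⟩ := exists_derivation_of_dual HL
    (fun x => (hfL _).symm.trans (RingHom.congr_fun hHL x))
  have dL_alg : ∀ p, dL (algebraMap R L p) = algebraMap R L (dR p) := by
    intro p
    rw [hdL, HL_alg, (hHRL p).2]
    exact hdRL p
  have hcomm : ∀ x : L, sL (dL x) = dL (sL x) := by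
    intro x
    obtain ⟨p, q, hq, rfl⟩ := IsFractionRing.div_surjective (A := R) x
    simp only [Derivation.leibniz_div, map_mul, map_sub, map_pow, map_inv₀, sL_alg, dL_alg,
      smul_eq_mul, Sd, map_div₀]
  let iL : SigmaDeltaField L := ⟨sL, dL, hcomm⟩
  let Y : Matrix (Fin m) (Fin m) L := fun a b => algebraMap R L (X (a, b, 0))
  have hY : matrixDerivatives Y = fun i => algebraMap R L (X i) := by
    funext ⟨a, b, j⟩
    show (⇑dL)^[j] (algebraMap R L (X (a, b, 0))) = _
    rw [← dRX' j]
    generalize (X (a, b, 0) : R) = p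
    induction j generalizing p with
    | zero => rfl
    | succ j ih => rw [Function.iterate_succ_apply, dL_alg, ih, ← Function.iterate_succ_apply]
  refine ⟨L, inferInstance, inferInstance, iL, Y, ⟨?_, ?_⟩, ?_, ?_, ?_⟩
  · intro a
    rw [IsScalarTower.algebraMap_apply k R L, IsScalarTower.algebraMap_apply k R L]
    exact (sL_alg _).trans (congrArg _ (SC a))
  · intro a
    rw [IsScalarTower.algebraMap_apply k R L, IsScalarTower.algebraMap_apply k R L]
    exact (dL_alg _).trans (congrArg _ (dRC a))
  · rw [hY]
    have := (MvPolynomial.algebraicIndependent_X (Fin m × Fin m × ℕ) k).map'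
      (f := IsScalarTower.toAlgHom k R L) (IsFractionRing.injective R L)
    exact this
  · rw [hY, eq_top_iff]
    rintro x -
    set E := IntermediateField.adjoin k (Set.range fun i => algebraMap R L (X i)) with hE
    have hR : ∀ p : R, algebraMap R L p ∈ E := by
      intro p
      induction p using MvPolynomial.induction_on with
      | C a => exact E.algebraMap_mem a
      | add p q hp hq => rw [map_add]; exact E.add_mem hp hq
      | mul_X p i hp =>
        rw [map_mul]
        exact E.mul_mem hp (IntermediateField.subset_adjoin k _ ⟨i, rfl⟩)
    obtain ⟨p, q, hq, rfl⟩ := IsFractionRing.div_surjective (A := R) x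
    exact E.div_mem (hR p) (hR q)
  · ext a b
    show sL (algebraMap R L (X (a, b, 0))) = _
    rw [sL_alg, SX, Matrix.mul_apply, map_sum]
    refine Finset.sum_congr rfl fun c _ => ?_
    rw [map_mul]
    rfl

end

/-! Write `F = k C_L`. Since `σ` and `δ` commute, `F` is stable under `δ`, and `L` is generated over
`F` as a differential field by the finitely many entries of `X`. The first claim is then a general
fact in characteristic zero, `Derivation.finiteDimensional_algebraicClosure`. List all derivatives
of the `n` generators as one sequence with `d (y t) = y (t + n)`, and let `K t` be generated by the
terms before `y t`. If `y t` is algebraic over `K t`, differentiating its minimal polynomial gives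
`y (t + n) ∈ K (t + n)`. Hence from some `N` on each `y t` either lies in `K t` or is transcendental
over it. Neither case adds elements algebraic over `F`, so the closure lies in the finitely
generated field `K N`, where it is finite.

For the second claim, `D_L` is the set of `σ`-periodic elements. As `D_k = C_k`, an Artin-style
argument shows that elements of `D_L` independent over `C_k` are independent over `k`
(`linearIndependent_of_mem_algConstants`). Applied to products of bases, this makes a `C_L`-basis of
`D_L` independent over `F`. It lies in the closure of `F`, so it is finite. -/

/-! ### Algebraic elements in transcendental and finitely generated extensions -/

open IntermediateField algebraAdjoinAdjoin in
/-- Algebraic elements which are linearly independent over `F` remain so over a purely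
transcendental extension of `F`. -/
theorem AlgebraicIndependent.linearIndependent_adjoin {F L ι κ : Type*} [Field F] [Field L]
    [Algebra F L] {s : ι → L} (hs : AlgebraicIndependent F s) {v : κ → L}
    (hv : LinearIndependent F v) (halg : ∀ i, IsAlgebraic F (v i)) :
    LinearIndependent (adjoin F (Set.range s)) v := by
  rw [← LinearIndependent.iff_fractionRing (R := Algebra.adjoin F (Set.range s))]
  -- `s` stays algebraically independent over the algebraic closure of `F` in `L`, so a relation
  -- among the `v i` with polynomial coefficients can be compared monomial by monomial.
  have hs' := hs.algebraicClosure
  let w : κ → algebraicClosure F L := fun i => ⟨v i, mem_algebraicClosure_iff.2 (halg i)⟩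
  have hw : LinearIndependent F w :=
    LinearIndependent.of_comp (algebraicClosure F L).val.toLinearMap hv
  have hP : ∀ g : Algebra.adjoin F (Set.range s), ∃ P : MvPolynomial ι F,
      MvPolynomial.aeval s P = (g : L) := by
    rintro ⟨g, hg⟩
    rw [Algebra.adjoin_range_eq_range_aeval] at hg
    exact hg
  choose P hP using hP
  rw [linearIndependent_iff']
  intro t g hg i hi
  have h0 : ∑ i ∈ t, MvPolynomial.C (w i) *
      (P (g i)).map (algebraMap F (algebraicClosure F L)) = 0 := by
    apply (algebraicIndependent_iff_injective_aeval.1 hs')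
    rw [map_zero, ← hg, map_sum]
    refine Finset.sum_congr rfl fun j _ => ?_
    rw [map_mul, MvPolynomial.aeval_C, MvPolynomial.aeval_map_algebraMap, hP, Algebra.smul_def,
      mul_comm]
    rfl
  have h1 : P (g i) = 0 := by
    ext m
    have h2 := congrArg (MvPolynomial.coeff m) h0
    rw [MvPolynomial.coeff_sum, MvPolynomial.coeff_zero] at h2
    refine (linearIndependent_iff'.1 hw) t (fun j => (P (g j)).coeff m) ?_ i hi
    rw [← h2]
    refine Finset.sum_congr rfl fun j _ => ?_
    rw [MvPolynomial.coeff_C_mul, MvPolynomial.coeff_map, Algebra.smul_def, mul_comm]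
  have h3 := hP (g i)
  rw [h1, map_zero] at h3
  exact Subtype.ext h3.symm

open IntermediateField in
/-- A field is relatively algebraically closed in a simple transcendental extension. -/
theorem Transcendental.mem_bot_of_mem_adjoin {K L : Type*} [Field K] [Field L] [Algebra K L]
    {y a : L} (hy : Transcendental K y) (ha : a ∈ K⟮y⟯) (halg : IsAlgebraic K a) :
    a ∈ (⊥ : IntermediateField K L) := by
  by_contra hb
  have hv : LinearIndependent K ![1, a] := by
    rw [LinearIndependent.pair_iff]
    intro c d h
    have hd : d = 0 := by
      by_contra hd
      refine hb (mem_bot.2 ⟨-c / d, ?_⟩)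
      have hd' : algebraMap K L d ≠ 0 := by simpa using hd
      rw [Algebra.smul_def, Algebra.smul_def, mul_one] at h
      rw [map_div₀, map_neg, div_eq_iff hd']
      linear_combination -h
    subst hd
    simpa [Algebra.smul_def] using h
  have hs : AlgebraicIndependent K (fun _ : Unit => y) :=
    algebraicIndependent_unique_type_iff.2 hy
  have h := hs.linearIndependent_adjoin hv (by
    intro i
    fin_cases i
    · exact isAlgebraic_one
    · exact halg)
  rw [Set.range_const, LinearIndependent.pair_iff] at h
  -- Over `K⟮y⟯`, which contains `a`, the pair satisfies `-a · 1 + 1 · a = 0`.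
  have := (h ⟨-a, neg_mem ha⟩ 1 (by simp [Algebra.smul_def, IntermediateField.algebraMap_apply])).2
  exact one_ne_zero this

open IntermediateField in
/-- The relative algebraic closure of `F` in a finitely generated field extension is finite. -/
theorem finiteDimensional_algebraicClosure_of_essFiniteType (F K : Type*) [Field F] [Field K]
    [Algebra F K] [Algebra.EssFiniteType F K] :
    FiniteDimensional F (algebraicClosure F K) := by
  obtain ⟨s, hs⟩ := exists_isTranscendenceBasis F K
  have : Algebra.IsAlgebraic (adjoin F (Set.range ((↑) : s → K))) K := hs.isAlgebraic_field
  have : Algebra.EssFiniteType (adjoin F (Set.range ((↑) : s → K))) K :=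
    Algebra.EssFiniteType.of_comp F _ K
  have : FiniteDimensional (adjoin F (Set.range ((↑) : s → K))) K :=
    Algebra.finite_of_essFiniteType_of_isAlgebraic
  let b := Module.Basis.ofVectorSpace F (algebraicClosure F K)
  have hb : LinearIndependent F fun i => (b i : K) :=
    b.linearIndependent.map' (algebraicClosure F K).val.toLinearMap
      (LinearMap.ker_eq_bot.2 Subtype.val_injective)
  -- The basis stays independent over the field generated by `s`, over which `K` has finite degree.
  have := (hs.1.linearIndependent_adjoin hb fun i => mem_algebraicClosure_iff.1 (b i).2).finite
  exact Module.Finite.of_basis b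

/-- If the relative algebraic closure of `F` in `L` lies in a finitely generated subextension,
it is finite over `F`. -/
theorem finiteDimensional_algebraicClosure_of_le {F L : Type*} [Field F] [Field L]
    [Algebra F L] {K : IntermediateField F L} (hK : K.FG) (h : algebraicClosure F L ≤ K) :
    FiniteDimensional F (algebraicClosure F L) := by
  have := IntermediateField.essFiniteType_iff.2 hK
  have := finiteDimensional_algebraicClosure_of_essFiniteType F K
  let f : algebraicClosure F L →ₗ[F] K := (IntermediateField.inclusion h).toLinearMap
  have hf : ∀ x, f x ∈ (algebraicClosure F K).toSubalgebra.toSubmodule := by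
    intro x
    refine mem_algebraicClosure_iff.2 ?_
    exact (isAlgebraic_algHom_iff K.val Subtype.val_injective).1
      (mem_algebraicClosure_iff.1 x.2)
  exact Module.Finite.of_injective
    (N := (algebraicClosure F K).toSubalgebra.toSubmodule) (f.codRestrict _ hf)
    fun x y hxy => IntermediateField.inclusion_injective h (congrArg Subtype.val hxy)

/-! ### Derivations and relative algebraic closures -/

/-- The chain rule for a derivation and a polynomial with variable coefficients. -/
theorem Derivation.eval_eq {L : Type*} [Field L] (d : Derivation ℤ L L) (p : Polynomial L)
    (y : L) : d (p.eval y) = (p.sum fun i a => d a * y ^ i) + p.derivative.eval y * d y := by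
  induction p using Polynomial.induction_on' with
  | add p q hp hq =>
    rw [Polynomial.eval_add, map_add, hp, hq, Polynomial.derivative_add, Polynomial.eval_add,
      Polynomial.sum_add_index p q _ (by simp) (by intros; rw [map_add, add_mul])]
    ring
  | monomial n a =>
    rw [Polynomial.sum_monomial_index _ _ (by simp)]
    simp only [Polynomial.eval_monomial, Derivation.leibniz, Derivation.leibniz_pow, smul_eq_mul,
      Polynomial.derivative_monomial, nsmul_eq_mul]
    ring

open IntermediateField in
/-- The derivative of an element `y` algebraic over `K` lies in every field containing `K`, `y`
and the derivatives of the elements of `K`. -/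
theorem Derivation.mem_of_isAlgebraic {F L : Type*} [Field F] [CharZero F] [Field L] [Algebra F L]
    (d : Derivation ℤ L L) {K K' : IntermediateField F L} (hle : K ≤ K')
    (hd : ∀ a ∈ K, d a ∈ K') {y : L} (hy : y ∈ K') (halg : IsAlgebraic K y) : d y ∈ K' := by
  set p := (minpoly K y).map (algebraMap K L) with hp
  have hcoeff : ∀ i, p.coeff i ∈ K := fun i => by
    rw [hp, Polynomial.coeff_map]
    exact ((minpoly K y).coeff i).2
  have h0 : p.eval y = 0 := by
    rw [hp, Polynomial.eval_map_algebraMap, minpoly.aeval]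
  have h1 : p.derivative.eval y ≠ 0 := by
    rw [hp, Polynomial.derivative_map, Polynomial.eval_map_algebraMap]
    have : CharZero K := charZero_of_injective_algebraMap (algebraMap F K).injective
    exact (minpoly.irreducible halg.isIntegral).separable.aeval_derivative_ne_zero
      (minpoly.aeval K y)
  -- Differentiating `p(y) = 0` is a linear equation for `d y`; its leading coefficient `p'(y)` is
  -- nonzero by separability.
  have h2 := d.eval_eq p y
  rw [h0, map_zero] at h2
  have h3 : d y = -(p.sum fun i a => d a * y ^ i) / p.derivative.eval y := by
    rw [eq_div_iff h1]
    linear_combination -h2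
  rw [h3]
  refine div_mem (neg_mem (sum_mem fun i _ => mul_mem (hd _ (hcoeff i)) (pow_mem hy i))) ?_
  rw [Polynomial.eval_eq_sum]
  refine sum_mem fun i _ => mul_mem ?_ (pow_mem hy i)
  rw [Polynomial.coeff_derivative]
  exact mul_mem (hle (hcoeff _)) (add_mem (_root_.natCast_mem K' i) (one_mem K'))

open IntermediateField in
/-- If `d` maps `F` to itself and maps generators into `K'`, it maps the generated field to `K'`. -/
theorem Derivation.mem_of_mem_adjoin {F L : Type*} [Field F] [Field L] [Algebra F L]
    (d : Derivation ℤ L L) (hF : ∀ a : F, ∃ b : F, d (algebraMap F L a) = algebraMap F L b)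
    {S : Set L} {K' : IntermediateField F L} (hS : S ⊆ K') (hd : ∀ a ∈ S, d a ∈ K') {x : L}
    (hx : x ∈ adjoin F S) : d x ∈ K' := by
  have hle : adjoin F S ≤ K' := adjoin_le_iff.2 hS
  induction hx using adjoin_induction with
  | mem a ha => exact hd a ha
  | algebraMap a =>
    obtain ⟨b, hb⟩ := hF a
    rw [hb]
    exact K'.algebraMap_mem b
  | add a b ha hb iha ihb => rw [map_add]; exact add_mem iha ihb
  | inv a ha iha =>
    rw [Derivation.leibniz_inv]
    exact mul_mem (neg_mem (pow_mem (inv_mem (hle ha)) 2)) iha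
  | mul a b ha hb iha ihb =>
    rw [Derivation.leibniz]
    exact add_mem (mul_mem (hle ha) ihb) (mul_mem (hle hb) iha)

open IntermediateField in
/-- A field extension generated by a sequence shifted by a derivation has finite relative
algebraic closure. -/
theorem Derivation.finiteDimensional_algebraicClosure_of_sequence {F L : Type*} [Field F]
    [CharZero F] [Field L] [Algebra F L] (d : Derivation ℤ L L)
    (hF : ∀ a : F, ∃ b : F, d (algebraMap F L a) = algebraMap F L b) {n : ℕ} (hn : 0 < n)
    (y : ℕ → L) (hy : ∀ t, d (y t) = y (t + n)) (htop : adjoin F (Set.range y) = ⊤) :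
    FiniteDimensional F (algebraicClosure F L) := by
  let K : ℕ → IntermediateField F L := fun t => adjoin F (y '' Set.Iio t)
  have Kmono : Monotone K := fun a b hab =>
    adjoin.mono _ _ _ (Set.image_mono (Set.Iio_subset_Iio hab))
  have hyK : ∀ {s t}, s < t → y s ∈ K t := fun {s t} h => subset_adjoin _ _ ⟨s, h, rfl⟩
  have Ksucc : ∀ t, ∀ a ∈ K (t + 1), a ∈ (K t)⟮y t⟯ := by
    intro t a ha
    have h1 : y '' Set.Iio (t + 1) = y '' Set.Iio t ∪ {y t} := by
      rw [← Set.image_singleton, ← Set.image_union]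
      congr 1
      ext s
      simp only [Set.mem_Iio, Set.mem_union, Set.mem_singleton_iff]
      omega
    have h2 : a ∈ adjoin F (y '' Set.Iio t ∪ {y t}) := h1 ▸ ha
    rw [← adjoin_adjoin_left] at h2
    exact h2
  have hstep : ∀ t, IsAlgebraic (K t) (y t) → y (t + n) ∈ K (t + n) := by
    intro t ht
    rw [← hy]
    refine d.mem_of_isAlgebraic (Kmono (Nat.le_add_right t n)) ?_ (hyK (by omega)) ht
    intro a ha
    refine d.mem_of_mem_adjoin hF ?_ ?_ ha
    · rintro _ ⟨s, hs, rfl⟩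
      exact hyK (Nat.lt_add_right n hs)
    · rintro _ ⟨s, hs, rfl⟩
      rw [hy]
      exact hyK (Nat.add_lt_add_right hs n)
  have hmem : ∀ t, y t ∈ K t → IsAlgebraic (K t) (y t) := fun t h =>
    isAlgebraic_algebraMap (⟨y t, h⟩ : K t)
  -- In each residue class mod `n`, one algebraic term forces all later ones into the field of their
  -- predecessors; otherwise every term is transcendental.
  have hres : ∀ r, ∃ N, ∀ j ≥ N, y (r + j * n) ∈ K (r + j * n) ∨
      Transcendental (K (r + j * n)) (y (r + j * n)) := by
    intro r
    by_cases h : ∃ j, IsAlgebraic (K (r + j * n)) (y (r + j * n))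
    · obtain ⟨j₀, hj₀⟩ := h
      refine ⟨j₀ + 1, fun j hj => Or.inl ?_⟩
      have : ∀ j ≥ j₀, IsAlgebraic (K (r + j * n)) (y (r + j * n)) := by
        intro j hj
        induction j, hj using Nat.le_induction with
        | base => exact hj₀
        | succ j _ ih =>
          have := hmem _ (hstep _ ih)
          rwa [add_assoc, ← Nat.succ_mul] at this
      obtain ⟨i, rfl⟩ : ∃ i, j = i + 1 := ⟨j - 1, by omega⟩
      have := hstep _ (this i (by omega))
      rwa [add_assoc, ← Nat.succ_mul] at this
    · exact ⟨0, fun j _ => Or.inr fun hj => h ⟨j, hj⟩⟩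
  choose M hM using hres
  -- For `t ≥ N`, the quotient `t / n` is at least `M r` for every residue `r`; the last summand `n`
  -- is slack.
  let N := (∑ r ∈ Finset.range n, M r) * n + n
  have hN : ∀ t ≥ N, y t ∈ K t ∨ Transcendental (K t) (y t) := by
    intro t ht
    have h1 : t % n + t / n * n = t := by rw [mul_comm]; exact Nat.mod_add_div t n
    have h2 : M (t % n) ≤ t / n := by
      refine (Finset.single_le_sum (fun _ _ => Nat.zero_le _)
        (Finset.mem_range.2 (Nat.mod_lt t hn))).trans ((Nat.le_div_iff_mul_le hn).2 ?_)
      exact (Nat.le_add_right _ n).trans ht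
    have := hM _ _ h2
    rwa [h1] at this
  refine finiteDimensional_algebraicClosure_of_le (K := K N)
    (fg_adjoin_of_finite ((Set.finite_Iio N).image y)) ?_
  intro a ha
  have ha : IsAlgebraic F a := mem_algebraicClosure_iff.1 ha
  have hex : ∃ t, a ∈ K t := by
    have h1 : a ∈ adjoin F (Set.range y) := htop ▸ mem_top
    have h2 : adjoin F (Set.range y) ≤ ⨆ t, K t := by
      refine adjoin_le_iff.2 ?_
      rintro _ ⟨t, rfl⟩
      exact (le_iSup K (t + 1)) (hyK (Nat.lt_succ_self t))
    have h3 := h2 h1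
    rwa [← SetLike.mem_coe, coe_iSup_of_directed Kmono.directed_le, Set.mem_iUnion] at h3
  obtain ⟨t, ht⟩ := hex
  rcases le_total t N with h | h
  · exact Kmono h ht
  induction t, h using Nat.le_induction with
  | base => exact ht
  | succ t hNt ih =>
    refine ih ?_
    have h1 := Ksucc t a ht
    rcases hN t hNt with h | h
    · have hbot : y t ∈ (⊥ : IntermediateField (K t) L) := mem_bot.2 ⟨⟨y t, h⟩, rfl⟩
      obtain ⟨b, rfl⟩ := mem_bot.1 (adjoin_simple_le_iff.2 hbot h1)
      exact b.2
    · obtain ⟨b, rfl⟩ := mem_bot.1 (h.mem_bot_of_mem_adjoin h1 (ha.tower_top (K t)))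
      exact b.2

open IntermediateField in
/-- In characteristic zero, the relative algebraic closure of a differential field in a finitely
generated differential field extension is a finite extension. -/
theorem Derivation.finiteDimensional_algebraicClosure {F L ι : Type*} [Field F]
    [CharZero F] [Field L] [Algebra F L] [Finite ι] (d : Derivation ℤ L L)
    (hF : ∀ a : F, ∃ b : F, d (algebraMap F L a) = algebraMap F L b) (x : ι → L)
    (htop : adjoin F {z | ∃ i j, (⇑d)^[j] (x i) = z} = ⊤) :
    FiniteDimensional F (algebraicClosure F L) := by
  -- The extra index `none` stands for the generator `0`, which keeps `n` positive even if `ι` is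
  -- empty.
  obtain ⟨n, ⟨e⟩⟩ := Finite.exists_equiv_fin (Option ι)
  have hn : 0 < n := Fin.pos (e none)
  let y : ℕ → L := fun t =>
    (⇑d)^[t / n] ((e.symm ⟨t % n, Nat.mod_lt t hn⟩).elim 0 x)
  refine d.finiteDimensional_algebraicClosure_of_sequence hF hn y ?_ ?_
  · intro t
    simp only [y]
    rw [← Function.iterate_succ_apply' (⇑d), Nat.add_div_right t hn]
    simp
  · rw [eq_top_iff, ← htop]
    refine adjoin.mono _ _ _ ?_
    rintro _ ⟨i, j, rfl⟩
    refine ⟨e (some i) + n * j, ?_⟩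
    have h1 : ((e (some i) : ℕ) + n * j) / n = j := by
      rw [Nat.add_mul_div_left _ _ hn, Nat.div_eq_of_lt (e (some i)).2, zero_add]
    have h2 : ((e (some i) : ℕ) + n * j) % n = e (some i) := by
      rw [Nat.add_mul_mod_self_left, Nat.mod_eq_of_lt (e (some i)).2]
    simp [y, h1, h2]

/-! ### Linear independence over a generated field -/

open IntermediateField.algebraAdjoinAdjoin in
/-- If a family `u` spans a submonoid `S` over `k` and the products `u j * v i` are linearly
independent over `k`, then `v` is linearly independent over `k(S)`. -/
theorem linearIndependent_adjoin_of_linearIndependent_mul {k L ι κ : Type*} [Field k] [Field L]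
    [Algebra k L] {S : Submonoid L} {u : ι → L} {v : κ → L}
    (hu : ∀ x ∈ S, x ∈ Submodule.span k (Set.range u))
    (huv : LinearIndependent k fun p : ι × κ => u p.1 * v p.2) :
    LinearIndependent (IntermediateField.adjoin k (S : Set L)) v := by
  classical
  -- Since `S` is closed under products, the algebra it generates is its `k`-span.
  have hspan : ∀ g : Algebra.adjoin k (S : Set L),
      ∃ c : ι →₀ k, (c.sum fun j a => a • u j) = (g : L) := by
    rintro ⟨g, hg⟩
    rw [← Finsupp.mem_span_range_iff_exists_finsupp]
    rw [← Subalgebra.mem_toSubmodule, Algebra.adjoin_eq_span, Submonoid.closure_eq] at hg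
    exact Submodule.span_le.2 hu hg
  choose c hc using hspan
  rw [← LinearIndependent.iff_fractionRing (Algebra.adjoin k (S : Set L)),
    linearIndependent_iff']
  intro t g hg i hi
  let J := t.biUnion fun i => (c (g i)).support
  have hcJ : ∀ i ∈ t, ∑ j ∈ J, c (g i) j • u j = (g i : L) := by
    intro i hi
    rw [← hc (g i), Finsupp.sum_of_support_subset (s := J) _
      (Finset.subset_biUnion_of_mem (fun i => (c (g i)).support) hi) _ (by simp)]
  have h0 : ∑ p ∈ J ×ˢ t, c (g p.2) p.1 • (u p.1 * v p.2) = 0 := by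
    rw [Finset.sum_product_right, ← hg]
    refine Finset.sum_congr rfl fun i hi => ?_
    rw [Algebra.smul_def]
    change _ = (g i : L) * v i
    rw [← hcJ i hi, Finset.sum_mul]
    simp only [smul_mul_assoc]
  have h1 : ∀ j ∈ J, c (g i) j = 0 := fun j hj =>
    linearIndependent_iff'.1 huv (J ×ˢ t) (fun p => c (g p.2) p.1) h0 (j, i)
      (Finset.mk_mem_product hj hi)
  refine Subtype.ext ?_
  rw [← hcJ i hi]
  exact Finset.sum_eq_zero fun j hj => by rw [h1 j hj, zero_smul]

/-! ### Algebraic over the constants means periodic under `σ` -/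

namespace SigmaDeltaField

/-- Elements algebraic over the constants are periodic under `σ`. -/
theorem mem_periodicPts_of_mem_algConstants {K : Type*} [Field K] [SigmaDeltaField K] {x : K}
    (hx : x ∈ algConstants K) : x ∈ Function.periodicPts (σ : K ≃+* K) := by
  have halg : IsAlgebraic (constants K) x := mem_algebraicClosure_iff.1 hx
  set p := (minpoly (constants K) x).map (algebraMap (constants K) K) with hp
  have hp0 : p ≠ 0 := Polynomial.map_ne_zero (minpoly.ne_zero halg.isIntegral)
  have hpσ : p.map ((σ : K ≃+* K) : K →+* K) = p := by
    ext i
    rw [Polynomial.coeff_map, hp, Polynomial.coeff_map]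
    exact ((minpoly (constants K) x).coeff i).2
  have hroot : ∀ i : ℕ, (⇑(σ : K ≃+* K))^[i] x ∈ {y | p.IsRoot y} := by
    intro i
    induction i with
    | zero =>
      simp only [Set.mem_ofPred_eq, Polynomial.IsRoot, Function.iterate_zero, id]
      rw [hp, Polynomial.eval_map_algebraMap, minpoly.aeval]
    | succ i ih =>
      rw [Function.iterate_succ_apply']
      have h := Polynomial.IsRoot.map (f := ((σ : K ≃+* K) : K →+* K)) ih
      rw [hpσ] at h
      exact h
  -- The orbit of `x` lies in the finite root set of `p`, so two iterates coincide.
  obtain ⟨i, -, j, -, hij, h⟩ := Set.infinite_univ.exists_lt_map_eq_of_mapsTo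
    (f := fun i : ℕ => (⇑(σ : K ≃+* K))^[i] x) (fun i _ => hroot i)
    (Polynomial.finite_setOfPred_isRoot hp0)
  refine ⟨j - i, Nat.sub_pos_of_lt hij, ?_⟩
  apply (σ : K ≃+* K).injective.iterate i
  rw [← Function.iterate_add_apply, Nat.add_sub_cancel' hij.le]
  exact h.symm

/-- Elements periodic under `σ` are algebraic over the constants. -/
theorem mem_algConstants_of_mem_periodicPts {K : Type*} [Field K] [SigmaDeltaField K] {x : K}
    (hx : x ∈ Function.periodicPts (σ : K ≃+* K)) : x ∈ algConstants K := by
  obtain ⟨s, hs, hsx⟩ := hx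
  let f : ℕ → Polynomial K := fun i =>
    Polynomial.X - Polynomial.C ((⇑(σ : K ≃+* K))^[i] x)
  -- `σ` shifts the factors cyclically, so the coefficients of `p` are constants.
  let p := ∏ i ∈ Finset.range s, f i
  have hpm : p.Monic := Polynomial.monic_prod_of_monic _ _ fun i _ => Polynomial.monic_X_sub_C _
  have hfs : f s = f 0 := by
    simp only [f]
    rw [hsx.eq]
    rfl
  have hpσ : p.map ((σ : K ≃+* K) : K →+* K) = p := by
    have h1 : p.map ((σ : K ≃+* K) : K →+* K) = ∏ i ∈ Finset.range s, f (i + 1) := by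
      rw [Polynomial.map_prod]
      refine Finset.prod_congr rfl fun i _ => ?_
      simp only [f, Function.iterate_succ_apply']
      simp
    have h2 : (∏ i ∈ Finset.range s, f (i + 1)) * f 0 = p * f 0 := by
      rw [← Finset.prod_range_succ', Finset.prod_range_succ, hfs]
    rw [h1]
    exact mul_right_cancel₀ (Polynomial.X_sub_C_ne_zero _) h2
  have hpl : p ∈ Polynomial.lifts (algebraMap (constants K) K) := by
    rw [Polynomial.lifts_iff_coeff_lifts]
    intro i
    refine ⟨⟨p.coeff i, ?_⟩, rfl⟩
    have := congrArg (fun q => Polynomial.coeff q i) hpσ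
    rwa [Polynomial.coeff_map] at this
  obtain ⟨q, hq, -, hqm⟩ := Polynomial.lifts_and_degree_eq_and_monic hpl hpm
  refine mem_algebraicClosure_iff.2 (IsIntegral.isAlgebraic ⟨q, hqm, ?_⟩)
  rw [← Polynomial.eval_map, hq, Polynomial.eval_prod]
  exact Finset.prod_eq_zero (Finset.mem_range.2 hs) (by simp [f])

/-! ### Linear disjointness over the compositum `k C_L` -/

section Extension

variable {k L : Type*} [Field k] [Field L] [Algebra k L] [SigmaDeltaField k] [SigmaDeltaField L]

theorem iterate_σ_algebraMap [SigmaDeltaExtension k L] (i : ℕ) (a : k) :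
    (⇑(σ : L ≃+* L))^[i] (algebraMap k L a) = algebraMap k L ((⇑(σ : k ≃+* k))^[i] a) := by
  induction i with
  | zero => rfl
  | succ i ih =>
    rw [Function.iterate_succ_apply', Function.iterate_succ_apply', ih,
      SigmaDeltaExtension.σ_algebraMap]

/-- Elements algebraic over the constants of `L` and linearly independent over the constants of
`k` are linearly independent over `k`. -/
theorem linearIndependent_of_mem_algConstants [SigmaDeltaExtension k L]
    (hk : algConstants k = ⊥) {κ : Type*} {v : κ → L} (hv : LinearIndependent (constants k) v)
    (hvD : ∀ i, v i ∈ algConstants L) : LinearIndependent k v := by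
  classical
  have hper : ∀ i, ∃ s > 0, Function.IsPeriodicPt (σ : L ≃+* L) s (v i) := fun i =>
    mem_periodicPts_of_mem_algConstants (hvD i)
  choose s hs hsv using hper
  rw [linearIndependent_iff']
  intro t
  induction t using Finset.induction with
  | empty => simp
  | insert j t hj ih =>
    intro g hg
    suffices hgj : g j = 0 by
      rw [Finset.sum_insert hj, hgj, zero_smul, zero_add] at hg
      intro i hi
      rcases Finset.mem_insert.1 hi with rfl | hi
      · exact hgj
      · exact ih g hg i hi
    by_contra hgj
    -- With the coefficient of `v j` normalised to `1`, applying `σ^S` for a common period `S` and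
    -- subtracting leaves a shorter relation. By induction it is trivial, so all `h i` are periodic,
    -- hence in `C_k`, against independence over `C_k`.
    let h : κ → k := fun i => (g j)⁻¹ * g i
    have hh : ∑ i ∈ insert j t, h i • v i = 0 := by
      simp only [h, mul_smul]
      rw [← Finset.smul_sum, hg, smul_zero]
    have hhj : h j = 1 := inv_mul_cancel₀ hgj
    let S := ∏ i ∈ insert j t, s i
    have hS : 0 < S := Finset.prod_pos fun i _ => hs i
    have hSv : ∀ i ∈ insert j t, (⇑(σ : L ≃+* L))^[S] (v i) = v i := fun i hi =>
      (hsv i).trans_dvd (Finset.dvd_prod_of_mem s hi)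
    let τ : k → k := (⇑(σ : k ≃+* k))^[S]
    have hτ : ∑ i ∈ insert j t, τ (h i) • v i = 0 := by
      have h1 := congrArg (⇑(σ : L ≃+* L))^[S] hh
      rw [iterate_map_zero, ← RingAut.coe_pow, map_sum] at h1
      rw [← h1]
      refine Finset.sum_congr rfl fun i hi => ?_
      rw [Algebra.smul_def, Algebra.smul_def, map_mul, RingAut.coe_pow, hSv i hi, iterate_σ_algebraMap]
    have hsub : ∑ i ∈ t, (τ (h i) - h i) • v i = 0 := by
      have h1 : ∑ i ∈ insert j t, (τ (h i) - h i) • v i = 0 := by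
        simp only [sub_smul]
        rw [Finset.sum_sub_distrib, hτ, hh, sub_zero]
      rw [Finset.sum_insert hj, hhj] at h1
      simpa [τ, iterate_map_one] using h1
    have hfix : ∀ i ∈ insert j t, τ (h i) = h i := by
      intro i hi
      rcases Finset.mem_insert.1 hi with rfl | hi
      · rw [hhj]
        exact iterate_map_one _ _
      · exact sub_eq_zero.1 (ih _ hsub i hi)
    have hconst : ∀ i ∈ insert j t, h i ∈ constants k := by
      intro i hi
      have h1 : h i ∈ algConstants k := mem_algConstants_of_mem_periodicPts ⟨S, hS, hfix i hi⟩
      rw [hk] at h1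
      obtain ⟨c, hc⟩ := IntermediateField.mem_bot.1 h1
      rw [← hc]
      exact c.2
    let c : κ → constants k := fun i => if hi : h i ∈ constants k then ⟨h i, hi⟩ else 0
    have hc : ∀ i ∈ insert j t, (c i : k) = h i := fun i hi => by
      simp only [c, dif_pos (hconst i hi)]
    have h0 : c j = 0 := by
      refine (linearIndependent_iff'.1 hv) (insert j t) c ?_ j (Finset.mem_insert_self j t)
      rw [← hh]
      refine Finset.sum_congr rfl fun i hi => ?_
      rw [← hc i hi]
      rfl
    have h1 := hc j (Finset.mem_insert_self j t)
    rw [h0, hhj] at h1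
    exact zero_ne_one h1

theorem algebraMap_mem_constants [SigmaDeltaExtension k L] {a : k} (ha : a ∈ constants k) :
    algebraMap k L a ∈ constants L :=
  (SigmaDeltaExtension.σ_algebraMap a).trans (congrArg _ ha)

/-- The constants of `L` are spanned over `k` by a family whose products with linearly independent
elements of `D_L` are linearly independent over `k`. -/
theorem exists_span_constants [SigmaDeltaExtension k L] (hk : algConstants k = ⊥) {κ : Type*}
    {v : κ → L} (hv : LinearIndependent (constants L) v) (hvD : ∀ i, v i ∈ algConstants L) :
    ∃ (ι : Set (constants L)) (u : ι → L), (∀ x ∈ constants L, x ∈ Submodule.span k (Set.range u)) ∧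
      LinearIndependent k fun p : ι × κ => u p.1 * v p.2 := by
  let φ : constants k →+* constants L :=
    ((algebraMap k L).comp (constants k).subtype).codRestrict (constants L)
      fun a => algebraMap_mem_constants (k := k) a.2
  let _ : Algebra (constants k) (constants L) := φ.toAlgebra
  have : IsScalarTower (constants k) (constants L) L := IsScalarTower.of_algebraMap_eq fun _ => rfl
  let b := Module.Basis.ofVectorSpace (constants k) (constants L)
  refine ⟨_, fun j => (b j : L), ?_, ?_⟩
  · intro x hx
    have h1 := congrArg (algebraMap (constants L) L) (b.linearCombination_repr ⟨x, hx⟩)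
    rw [Finsupp.linearCombination_apply, Finsupp.sum, map_sum] at h1
    have h2 : x = algebraMap (constants L) L ⟨x, hx⟩ := rfl
    rw [h2, ← h1]
    refine Submodule.sum_mem _ fun j _ => ?_
    have h3 : algebraMap (constants L) L (b.repr ⟨x, hx⟩ j • b j) =
        ((b.repr ⟨x, hx⟩ j : constants k) : k) • (b j : L) := by
      rw [Algebra.smul_def, Algebra.smul_def, map_mul]
      rfl
    rw [h3]
    exact Submodule.smul_mem _ _ (Submodule.subset_span ⟨j, rfl⟩)
  · have hb := b.linearIndependent
    -- The tower law gives independence over `C_k`; the products lie in `D_L`, so it extends to `k`.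
    have hbv := linearIndependent_smul (A := L) hb hv
    refine linearIndependent_of_mem_algConstants hk hbv fun p => ?_
    exact mul_mem ((algConstants L).algebraMap_mem (b p.1)) (hvD p.2)

/-- Elements algebraic over the constants of `L` and linearly independent over them are linearly
independent over the compositum of `k` and the constants. -/
theorem linearIndependent_compositumConstants [SigmaDeltaExtension k L]
    (hk : algConstants k = ⊥) {κ : Type*} {v : κ → L} (hv : LinearIndependent (constants L) v)
    (hvD : ∀ i, v i ∈ algConstants L) : LinearIndependent (compositumConstants k L) v := by
  obtain ⟨ι, u, hu, huv⟩ := exists_span_constants hk hv hvD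
  exact linearIndependent_adjoin_of_linearIndependent_mul (S := (constants L).toSubmonoid) hu huv

/-- The derivation of `L` maps the compositum of `k` and the constants to itself. -/
theorem δ_mem_compositumConstants [SigmaDeltaExtension k L] {x : L}
    (hx : x ∈ compositumConstants k L) : δ x ∈ compositumConstants k L := by
  refine (δ : Derivation ℤ L L).mem_of_mem_adjoin
    (fun a => ⟨δ a, SigmaDeltaExtension.δ_algebraMap a⟩)
    (IntermediateField.subset_adjoin k _) (fun a ha => ?_) hx
  refine IntermediateField.subset_adjoin k _ ?_
  exact (σ_δ_comm a).trans (congrArg _ ha)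

omit [SigmaDeltaField k] in
theorem algConstants_le_algebraicClosure_compositumConstants {x : L}
    (hx : x ∈ algConstants L) : x ∈ algebraicClosure (compositumConstants k L) L := by
  have halg : IsAlgebraic (constants L) x := mem_algebraicClosure_iff.1 hx
  let φ : constants L →+* compositumConstants k L :=
    (constants L).subtype.codRestrict (compositumConstants k L)
      fun a => IntermediateField.subset_adjoin k _ a.2
  let : Algebra (constants L) (compositumConstants k L) := φ.toAlgebra
  have : IsScalarTower (constants L) (compositumConstants k L) L :=
    IsScalarTower.of_algebraMap_eq fun _ => rfl
  exact mem_algebraicClosure_iff.2 (halg.tower_top _)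

end Extension

end SigmaDeltaField

/-! ### The two finiteness statements -/

open SigmaDeltaField in
theorem mainTheorem7 {k L : Type*} [Field k] [CharZero k] [SigmaDeltaField k]
    [Field L] [Algebra k L] [SigmaDeltaField L]
    (hk : SigmaDeltaField.algConstants k = ⊥)
    {m : ℕ} (A : GL (Fin m) k) (X : Matrix (Fin m) (Fin m) L)
    (hX : IsGenericSolutionField A X) :
    FiniteDimensional (compositumConstants k L)
        (algebraicClosure (compositumConstants k L) L) ∧
      FiniteDimensional (SigmaDeltaField.constants L) (SigmaDeltaField.algConstants L) := by
  have := hX.extension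
  have : CharZero (compositumConstants k L) :=
    charZero_of_injective_algebraMap (algebraMap k (compositumConstants k L)).injective
  have hfin : FiniteDimensional (compositumConstants k L)
      (algebraicClosure (compositumConstants k L) L) := by
    refine (δ : Derivation ℤ L L).finiteDimensional_algebraicClosure
      (fun a => ⟨⟨δ (a : L), δ_mem_compositumConstants a.2⟩, rfl⟩)
      (fun p : Fin m × Fin m => X p.1 p.2) ?_
    -- Generators of `L` over `k` also generate it over the larger field `k C_L`.
    refine IntermediateField.adjoin_eq_top_of_adjoin_eq_top k ?_
    rw [← hX.generates]
    congr 1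
    ext z
    constructor
    · rintro ⟨p, j, rfl⟩
      exact ⟨(p.1, p.2, j), rfl⟩
    · rintro ⟨p, rfl⟩
      exact ⟨(p.1, p.2.1), p.2.2, rfl⟩
  refine ⟨hfin, ?_⟩
  let b := Module.Basis.ofVectorSpace (constants L) (algConstants L)
  have hb : LinearIndependent (compositumConstants k L) fun i => (b i : L) :=
    linearIndependent_compositumConstants hk
      (b.linearIndependent.map' (algConstants L).val.toLinearMap
        (LinearMap.ker_eq_bot.2 Subtype.val_injective)) fun i => (b i).2
  -- The `C_L`-basis of `D_L`, viewed in the closure of `k C_L`, which is finite-dimensional by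
  -- `hfin`.
  let w := fun i => (⟨b i, algConstants_le_algebraicClosure_compositumConstants (b i).2⟩ :
    algebraicClosure (compositumConstants k L) L)
  have hw : LinearIndependent (compositumConstants k L) w :=
    LinearIndependent.of_comp (algebraicClosure (compositumConstants k L) L).val.toLinearMap hb
  have := hw.finite
  exact Module.Finite.of_basis b
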